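/- Let $d\lambda(z)=\frac1\pi e^{-|z|^2}\,dA(z)$ be the Gaussian measure on $\mathbb C$ ($dA$ is area measure), and let the Fock space $F^2$ be the Hilbert space of all entire functions $f$ with $\|f\|^2=\int_{\mathbb C}|f|^2\,d\lambda<\infty$, with the inner product of $L^2(\mathbb C,d\lambda)$. All functions are complex valued. There is exactly one unitary operator $B$ from $L^2(\mathbb R)$ onto $F^2$ with $$Bf(z)=\left(\frac2\pi\right)^{1/4}\int_{\mathbb R}f(x)\,e^{2xz-x^2-z^2/2}\,dx\qquad(f\in L^2(\mathbb R),\ z\in\mathbb C)$$ (the Bargmann transform), and exactly one unitary operator $F$ of $L^2(\mathbb R)$ onto itself with $$Ff(x)=\frac1{\sqrt\pi}\int_{\mathbb R}f(t)\,e^{2ixt}\,dt\quad\text{for almost every }x\in\mathbb R,\text{ for all }f\in L^1(\mathbb R)\cap L^2(\mathbb R)$$ (the Fourier transform). The inverse $F^{-1}$ is the inverse Fourier transform, that is, $F^{-1}f(x)=\frac1{\sqrt\pi}\int_{\mathbb R}f(t)\,e^{-2ixt}\,dt$ for almost every $x\in\mathbb R$, for all $f\in L^1(\mathbb R)\cap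 L^2(\mathbb R)$. The operator $T=BFB^{-1}:F^2\to F^2$ is given by $Tf(z)=f(iz)$ for all $f\in F^2$ and $z\in\mathbb C$. The operator $T^{-1}=BF^{-1}B^{-1}:F^2\to F^2$ is given by $T^{-1}f(z)=f(-iz)$ for all $f\in F^2$ and $z\in\mathbb C$. -/

import Mathlib

open MeasureTheory

noncomputable section

/-- The Gaussian probability measure `dλ(z) = π⁻¹ exp(-|z|²) dA(z)` on `ℂ`,
where `dA` is area measure. -/
def gaussC : Measure ℂ :=
  (volume : Measure ℂ).withDensity fun z => ENNReal.ofReal (Real.pi⁻¹ * Real.exp (-‖z‖ ^ 2))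

/-- The entire functions that are square integrable for the Gaussian measure, as a subspace of
the space of all functions `ℂ → ℂ`. -/
def fockSubmodule : Submodule ℂ (ℂ → ℂ) where
  carrier := {f | Differentiable ℂ f ∧ MemLp f 2 gaussC}
  add_mem' hf hg := ⟨hf.1.add hg.1, hf.2.add hg.2⟩
  zero_mem' := ⟨differentiable_const 0, MemLp.zero⟩
  smul_mem' a _ hf := ⟨hf.1.const_smul a, hf.2.const_smul a⟩

/-- The Fock space `F²`. It is a type of its own, so that it carries the norm of `L²(ℂ, dλ)` and
not the topology of pointwise convergence. -/
def FockSpace : Type := ↥fockSubmodule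

namespace FockSpace

instance : AddCommGroup FockSpace := inferInstanceAs (AddCommGroup ↥fockSubmodule)

instance : Module ℂ FockSpace := inferInstanceAs (Module ℂ ↥fockSubmodule)

instance : CoeFun FockSpace (fun _ => ℂ → ℂ) := ⟨fun f => f.1⟩

theorem memLp (f : FockSpace) : MemLp (f : ℂ → ℂ) 2 gaussC := f.2.2

theorem differentiable (f : FockSpace) : Differentiable ℂ (f : ℂ → ℂ) := f.2.1

/-- The inclusion of the Fock space in `L²(ℂ, dλ)`. -/
def toL2 : FockSpace →ₗ[ℂ] Lp ℂ 2 gaussC where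
  toFun f := f.memLp.toLp f
  map_add' f g := MemLp.toLp_add f.memLp g.memLp
  map_smul' a f := MemLp.toLp_const_smul a f.memLp

theorem volume_absolutelyContinuous_gaussC : (volume : Measure ℂ) ≪ gaussC := by
  refine withDensity_absolutelyContinuous' (by fun_prop) (Filter.Eventually.of_forall fun z => ?_)
  have : 0 < Real.pi⁻¹ * Real.exp (-‖z‖ ^ 2) := by positivity
  simpa using this

theorem toL2_injective : Function.Injective toL2 := by
  intro f g h
  have h1 : (f : ℂ → ℂ) =ᵐ[gaussC] g := (MemLp.toLp_eq_toLp_iff f.memLp g.memLp).1 h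
  have h2 : (f : ℂ → ℂ) =ᵐ[volume] g := volume_absolutelyContinuous_gaussC.ae_le h1
  exact Subtype.ext
    ((f.differentiable.continuous.ae_eq_iff_eq volume g.differentiable.continuous).1 h2)

/-- The norm and the inner product of the Fock space are those of `L²(ℂ, dλ)`. -/
instance : NormedAddCommGroup FockSpace :=
  NormedAddCommGroup.induced FockSpace (Lp ℂ 2 gaussC) toL2 toL2_injective

instance : InnerProductSpace ℂ FockSpace where
  norm_smul_le a f := by
    change ‖toL2 (a • f)‖ ≤ ‖a‖ * ‖toL2 f‖
    rw [map_smul]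
    exact norm_smul_le a (toL2 f)
  inner f g := inner ℂ (toL2 f) (toL2 g)
  norm_sq_eq_re_inner f := norm_sq_eq_re_inner (𝕜 := ℂ) (toL2 f)
  conj_inner_symm f g := inner_conj_symm (toL2 f) (toL2 g)
  add_left f g h := by
    rw [map_add]
    exact inner_add_left (toL2 f) (toL2 g) (toL2 h)
  smul_left f g a := by
    rw [map_smul]
    exact inner_smul_left (toL2 f) (toL2 g) a

/-- The inner product, with Mathlib's convention that it is conjugate linear on the left. -/
theorem inner_eq_integral (f g : FockSpace) :
    inner ℂ f g = ∫ z, starRingEnd ℂ (f z) * g z ∂gaussC := by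
  change inner ℂ (toL2 f) (toL2 g) = _
  rw [L2.inner_def]
  refine integral_congr_ae ?_
  filter_upwards [f.memLp.coeFn_toLp, g.memLp.coeFn_toLp] with z hf hg
  change inner ℂ (f.memLp.toLp f z) (g.memLp.toLp g z) = _
  rw [hf, hg, RCLike.inner_apply, mul_comm]

end FockSpace

/-- `L²(ℝ)`, with complex values. -/
abbrev L2R : Type := Lp ℂ 2 (volume : Measure ℝ)

/-- The Bargmann integral `c ∫ f(x) exp(2xz - x² - z²/2) dx` with `c = (2/π)^{1/4}`. -/
def bargmannIntegral (f : ℝ → ℂ) (z : ℂ) : ℂ :=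
  (((2 / Real.pi) ^ (1 / 4 : ℝ) : ℝ) : ℂ) *
    ∫ x : ℝ, f x * Complex.exp (2 * (x : ℂ) * z - (x : ℂ) ^ 2 - z ^ 2 / 2)

/-- The Fourier integral `π^{-1/2} ∫ f(t) exp(2ixt) dt`. -/
def fourierIntegralPi (f : ℝ → ℂ) (x : ℝ) : ℂ :=
  ((1 / Real.sqrt Real.pi : ℝ) : ℂ) *
    ∫ t : ℝ, f t * Complex.exp (2 * Complex.I * (x : ℂ) * (t : ℂ))

/-- The inverse Fourier integral `π^{-1/2} ∫ f(t) exp(-2ixt) dt`. -/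
def fourierIntegralPiInv (f : ℝ → ℂ) (x : ℝ) : ℂ :=
  ((1 / Real.sqrt Real.pi : ℝ) : ℂ) *
    ∫ t : ℝ, f t * Complex.exp (-2 * Complex.I * (x : ℂ) * (t : ℂ))

/-- `B` is the Bargmann transform, as a unitary operator from `L²(ℝ)` onto `F²`. -/
def IsBargmannTransform (B : L2R ≃ₗᵢ[ℂ] FockSpace) : Prop :=
  ∀ (f : L2R) (z : ℂ), B f z = bargmannIntegral f z

/-- `F` is the Fourier transform on `L²(ℝ)`: the unitary operator that is given by the Fourier
integral on the dense subspace `L¹(ℝ) ∩ L²(ℝ)`. -/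
def IsFourierTransform (F : L2R ≃ₗᵢ[ℂ] L2R) : Prop :=
  ∀ f : L2R, Integrable f volume → F f =ᵐ[volume] fourierIntegralPi f

/-- `G` is the inverse Fourier transform on `L²(ℝ)`: the unitary operator that is given by the
inverse Fourier integral on the dense subspace `L¹(ℝ) ∩ L²(ℝ)`. -/
def IsInverseFourierTransform (G : L2R ≃ₗᵢ[ℂ] L2R) : Prop :=
  ∀ f : L2R, Integrable f volume → G f =ᵐ[volume] fourierIntegralPiInv f

end

/-! For `z = u + iv` the Bargmann integral of `f` is a Gaussian factor times the Fourier integral at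
`v` of `f(t) exp(2tu - t²)`. Plancherel in `v`, Tonelli, and a translated Gaussian of mass one in
`u` make it isometric (`lintegral_enorm_bargmannIntegral_sq`).

It is onto because its range is closed and contains every `exp(conj w · z)`, the image of a
Gaussian; pairing with this function evaluates at `w` (`FockSpace.inner_exp_eq`), so nothing nonzero
is orthogonal to the range.

The Fourier integral of the Bargmann kernel at `z` is the kernel at `iz`
(`integral_cexp_mul_bargmannKernel`). Hence conjugating the quarter turn by `B` gives a unitary
operator that agrees with the Fourier integral on `L¹ ∩ L²`. By density it is the only one, so the
formulas for `T` and `T⁻¹` hold by construction. A sign `ε = ±1` treats both transforms at once. -/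

noncomputable section

open scoped FourierTransform ContDiff

/-! ### Plancherel on `L¹ ∩ L²` -/

/-- The `L²` Fourier transform of an integrable function is its Fourier integral. -/
theorem Lp_fourier_toLp_ae_eq {f : ℝ → ℂ} (h1 : Integrable f) (h2 : MemLp f 2) :
    (𝓕 (h2.toLp f) : Lp ℂ 2 (volume : Measure ℝ)) =ᵐ[volume] 𝓕 f := by
  have hcont : Continuous (𝓕 f) :=
    VectorFourier.fourierIntegral_continuous Real.continuous_fourierChar
      (innerSL ℝ).continuous₂ h1
  -- Against a smooth compactly supported test function, both the `L²` transform and the integral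
  -- transfer the Fourier transform to the test function.
  refine ae_eq_of_integral_contDiff_smul_eq
    ((Lp.memLp _).locallyIntegrable one_le_two) hcont.locallyIntegrable fun g hg hc => ?_
  have hc' : HasCompactSupport fun x => (g x : ℂ) := hc.comp_left Complex.ofReal_zero
  have hg' : ContDiff ℝ ∞ fun x => (g x : ℂ) := Complex.ofRealCLM.contDiff.comp hg
  set φ : SchwartzMap ℝ ℂ := hc'.toSchwartzMap hg' with hφ
  have hφg (x : ℝ) : φ x = (g x : ℂ) := rfl
  have key := congrArg (fun T => T φ) (Lp.fourier_toTemperedDistribution_eq (h2.toLp f))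
  simp only [TemperedDistribution.fourier_apply, Lp.toTemperedDistribution_apply] at key
  have hflip : ∫ ξ, 𝓕 f ξ * φ ξ = ∫ x, f x * 𝓕 (φ : ℝ → ℂ) x := by
    simpa using! VectorFourier.integral_fourierIntegral_smul_eq_flip (L := innerₗ ℝ)
      Real.continuous_fourierChar continuous_inner h1 φ.integrable
  calc ∫ x, g x • (𝓕 (h2.toLp f) : Lp ℂ 2 (volume : Measure ℝ)) x
      = ∫ x, φ x • (𝓕 (h2.toLp f) : Lp ℂ 2 (volume : Measure ℝ)) x := by
        simp [hφg]
    _ = ∫ x, (𝓕 φ) x • (h2.toLp f) x := key.symm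
    _ = ∫ x, f x * 𝓕 (φ : ℝ → ℂ) x := by
        refine integral_congr_ae ?_
        filter_upwards [h2.coeFn_toLp] with x hx
        rw [hx, SchwartzMap.fourier_coe, smul_eq_mul, mul_comm]
    _ = ∫ x, g x • 𝓕 f x := by
        rw [← hflip]
        simp [hφg, mul_comm]

theorem lintegral_enorm_sq_eq_eLpNorm_sq {α : Type*} [MeasurableSpace α] (μ : Measure α)
    (f : α → ℂ) : ∫⁻ x, ‖f x‖ₑ ^ 2 ∂μ = eLpNorm f 2 μ ^ 2 := by
  have := eLpNorm_nnreal_pow_eq_lintegral (μ := μ) (f := f) (p := 2) two_ne_zero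
  norm_num at this
  exact_mod_cast this.symm

theorem lintegral_enorm_fourier_sq {f : ℝ → ℂ} (h1 : Integrable f) (h2 : MemLp f 2) :
    ∫⁻ ξ, ‖𝓕 f ξ‖ₑ ^ 2 = ∫⁻ x, ‖f x‖ₑ ^ 2 := by
  rw [lintegral_enorm_sq_eq_eLpNorm_sq, lintegral_enorm_sq_eq_eLpNorm_sq,
    ← eLpNorm_congr_ae (Lp_fourier_toLp_ae_eq h1 h2), ← eLpNorm_congr_ae h2.coeFn_toLp,
    ← Lp.enorm_def, ← Lp.enorm_def, ← ofReal_norm, ← ofReal_norm, Lp.norm_fourier_eq]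

theorem lintegral_comp_mul_left_real (g : ℝ → ENNReal) {a : ℝ} (ha : a ≠ 0) :
    ∫⁻ x, g (a * x) = ENNReal.ofReal |a⁻¹| * ∫⁻ x, g x := by
  have he : MeasurableEmbedding fun x : ℝ => a * x :=
    (Homeomorph.mulLeft₀ a ha).measurableEmbedding
  rw [← he.lintegral_map g, Real.map_volume_mul_left ha, lintegral_smul_measure, smul_eq_mul]

/-- Plancherel's theorem for the Fourier integral with kernel `exp(iaxt)`. -/
theorem lintegral_enorm_integral_cexp_sq {f : ℝ → ℂ} (h1 : Integrable f) (h2 : MemLp f 2)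
    {a : ℝ} (ha : a ≠ 0) :
    ∫⁻ x : ℝ, ‖∫ t : ℝ, f t * Complex.exp (a * Complex.I * x * t)‖ₑ ^ 2 =
      ENNReal.ofReal (2 * Real.pi / |a|) * ∫⁻ t, ‖f t‖ₑ ^ 2 := by
  -- The kernel of `𝓕` is `exp(-2πixt)`, so the frequency is `-ax/(2π)`.
  have hb : -(a / (2 * Real.pi)) ≠ 0 := neg_ne_zero.2 (by positivity)
  have hF (x : ℝ) : ∫ t : ℝ, f t * Complex.exp (a * Complex.I * x * t) =
      𝓕 f (-(a / (2 * Real.pi)) * x) := by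
    rw [Real.fourier_real_eq_integral_exp_smul]
    refine integral_congr_ae (.of_forall fun t => ?_)
    simp only [smul_eq_mul]
    rw [mul_comm]
    congr 2
    push_cast
    have : (Real.pi : ℂ) ≠ 0 := by exact_mod_cast Real.pi_ne_zero
    field_simp
  simp_rw [hF]
  rw [lintegral_comp_mul_left_real (fun x => ‖𝓕 f x‖ₑ ^ 2) hb, lintegral_enorm_fourier_sq h1 h2]
  congr 2
  rw [abs_inv, abs_neg, abs_div, inv_div, abs_of_pos Real.two_pi_pos]

/-! ### Convergence and holomorphy of the Bargmann integral -/

theorem memLp_two_cexp_quadratic {b : ℂ} (hb : 0 < b.re) (c d : ℂ) :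
    MemLp (fun x : ℝ => Complex.exp (-b * x ^ 2 + c * x + d)) 2 := by
  rw [memLp_two_iff_integrable_sq_norm (by fun_prop)]
  have h2b : 0 < (2 * b).re := by simpa using hb
  refine (integrable_cexp_quadratic h2b (2 * c) (2 * d)).norm.congr (.of_forall fun x => ?_)
  simp only
  rw [← norm_pow, ← Complex.exp_nat_mul]
  congr 2
  push_cast
  ring

theorem memLp_two_bargmannKernel (z : ℂ) :
    MemLp (fun x : ℝ => Complex.exp (2 * (x : ℂ) * z - (x : ℂ) ^ 2 - z ^ 2 / 2)) 2 := by
  convert memLp_two_cexp_quadratic (b := 1) (by simp) (2 * z) (-z ^ 2 / 2) using 3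
  ring

theorem integrable_mul_bargmannKernel {f : ℝ → ℂ} (hf : MemLp f 2) (z : ℂ) :
    Integrable fun x : ℝ => f x * Complex.exp (2 * (x : ℂ) * z - (x : ℂ) ^ 2 - z ^ 2 / 2) :=
  hf.integrable_mul (memLp_two_bargmannKernel z)

theorem bargmannIntegral_congr_ae {f g : ℝ → ℂ} (h : f =ᵐ[volume] g) (z : ℂ) :
    bargmannIntegral f z = bargmannIntegral g z := by
  unfold bargmannIntegral
  congr 1
  refine integral_congr_ae ?_
  filter_upwards [h] with x hx
  rw [hx]

theorem bargmannIntegral_eq_mul (f : ℝ → ℂ) (z : ℂ) :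
    bargmannIntegral f z = (((2 / Real.pi) ^ (1 / 4 : ℝ) : ℝ) : ℂ) * (Complex.exp (-z ^ 2 / 2) *
      ∫ x : ℝ, f x * Complex.exp (2 * (x : ℂ) * z - (x : ℂ) ^ 2)) := by
  unfold bargmannIntegral
  rw [← integral_const_mul (Complex.exp (-z ^ 2 / 2))]
  congr 1
  refine integral_congr_ae (.of_forall fun x => ?_)
  simp only
  rw [sub_eq_add_neg _ (z ^ 2 / 2), Complex.exp_add]
  ring_nf

/-- A bound uniform in `‖z‖ ≤ R`, for differentiating under the integral. The factor `2x` costs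
`exp(2|x|)`, hence `R + 1`, and `(|x| - 2(R + 1))² ≥ 0` gives up half of the Gaussian decay. -/
theorem norm_deriv_bargmannKernel_le (x : ℝ) {z : ℂ} {R : ℝ} (hz : ‖z‖ ≤ R) :
    ‖2 * (x : ℂ) * Complex.exp (2 * (x : ℂ) * z - (x : ℂ) ^ 2)‖ ≤
      Real.exp (2 * (R + 1) ^ 2) * ‖Complex.exp (-(1 / 2 : ℂ) * x ^ 2 + 0 * x + 0)‖ := by
  have h1 : ‖2 * (x : ℂ)‖ ≤ Real.exp (2 * |x|) := by
    have := Real.add_one_le_exp (2 * |x|)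
    simp only [norm_mul, Complex.norm_ofNat, Complex.norm_real, Real.norm_eq_abs]
    linarith
  have hre : (2 * (x : ℂ) * z - (x : ℂ) ^ 2).re = 2 * (x * z.re) - x ^ 2 := by
    simp [pow_two]
    ring
  have hre' : (-(1 / 2 : ℂ) * x ^ 2 + 0 * x + 0).re = -(x ^ 2 / 2) := by
    simp [pow_two]
    ring
  have h2 : x * z.re ≤ |x| * R :=
    (le_abs_self _).trans (by
      rw [abs_mul]
      exact mul_le_mul_of_nonneg_left ((Complex.abs_re_le_norm z).trans hz) (abs_nonneg x))
  rw [norm_mul, Complex.norm_exp, Complex.norm_exp, hre, hre', ← Real.exp_add]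
  refine (mul_le_mul_of_nonneg_right h1 (Real.exp_pos _).le).trans ?_
  rw [← Real.exp_add]
  refine Real.exp_le_exp.2 ?_
  nlinarith [sq_nonneg (|x| - 2 * (R + 1)), sq_abs x]

theorem differentiable_integral_mul_cexp {f : ℝ → ℂ} (hf : MemLp f 2) :
    Differentiable ℂ fun z : ℂ =>
      ∫ x : ℝ, f x * Complex.exp (2 * (x : ℂ) * z - (x : ℂ) ^ 2) := by
  intro z₀
  have hmeas (z : ℂ) : AEStronglyMeasurable
      (fun x : ℝ => f x * Complex.exp (2 * (x : ℂ) * z - (x : ℂ) ^ 2)) volume :=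
    hf.1.mul (by fun_prop)
  have hint : Integrable fun x : ℝ => f x * Complex.exp (2 * (x : ℂ) * z₀ - (x : ℂ) ^ 2) := by
    refine hf.integrable_mul (q := 2) ?_
    convert memLp_two_cexp_quadratic (b := 1) (by simp) (2 * z₀) 0 using 3
    ring
  have hbound : Integrable fun x : ℝ => ‖f x‖ * (Real.exp (2 * (‖z₀‖ + 1 + 1) ^ 2) *
      ‖Complex.exp (-(1 / 2 : ℂ) * x ^ 2 + 0 * x + 0)‖) :=
    hf.norm.integrable_mul (q := 2)
      ((memLp_two_cexp_quadratic (by simp) 0 0).norm.const_mul _)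
  refine (hasDerivAt_integral_of_dominated_loc_of_deriv_le
    (F' := fun z x => f x * (2 * (x : ℂ) * Complex.exp (2 * (x : ℂ) * z - (x : ℂ) ^ 2)))
    (Metric.ball_mem_nhds z₀ one_pos) (.of_forall hmeas) hint (hf.1.mul (by fun_prop))
    (.of_forall fun x z hz => ?_) hbound
    (.of_forall fun x z _ => ?_)).2.differentiableAt
  · rw [norm_mul]
    refine mul_le_mul_of_nonneg_left (norm_deriv_bargmannKernel_le x ?_) (norm_nonneg _)
    have h1 : ‖z - z₀‖ < 1 := mem_ball_iff_norm.1 hz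
    linarith [norm_le_norm_add_norm_sub' z z₀]
  · have h : HasDerivAt (fun z : ℂ => 2 * (x : ℂ) * z - (x : ℂ) ^ 2) (2 * (x : ℂ)) z := by
      simpa using ((hasDerivAt_id z).const_mul (2 * (x : ℂ))).sub_const ((x : ℂ) ^ 2)
    simpa [mul_comm, mul_left_comm] using (h.cexp.const_mul (f x))

theorem differentiable_bargmannIntegral {f : ℝ → ℂ} (hf : MemLp f 2) :
    Differentiable ℂ (bargmannIntegral f) := by
  have h := differentiable_integral_mul_cexp hf
  rw [funext (bargmannIntegral_eq_mul f)]
  exact (((by fun_prop : Differentiable ℂ fun z : ℂ => Complex.exp (-z ^ 2 / 2))).mul h).const_mul _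

/-! ### The Bargmann integral as an isometry -/

theorem lintegral_gaussian_translate (t : ℝ) :
    ∫⁻ u : ℝ, ENNReal.ofReal (Real.sqrt (2 / Real.pi) * Real.exp (-2 * (u - t) ^ 2)) = 1 := by
  rw [lintegral_sub_right_eq_self
    (fun u => ENNReal.ofReal (Real.sqrt (2 / Real.pi) * Real.exp (-2 * u ^ 2))) t,
    ← ofReal_integral_eq_lintegral_ofReal
      ((integrable_exp_neg_mul_sq two_pos).const_mul _) (.of_forall fun x => by positivity),
    integral_const_mul, integral_gaussian, ← Real.sqrt_mul (by positivity)]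
  have : 2 / Real.pi * (Real.pi / 2) = 1 := by field_simp
  simp [this]

theorem lintegral_gaussC (g : ℂ → ENNReal) (hg : Measurable g) :
    ∫⁻ z, g z ∂gaussC = ∫⁻ u : ℝ, ∫⁻ v : ℝ,
      ENNReal.ofReal (Real.pi⁻¹ * Real.exp (-(u ^ 2 + v ^ 2))) * g (u + v * Complex.I) := by
  rw [gaussC, lintegral_withDensity_eq_lintegral_mul _ (by fun_prop) hg,
    ← Complex.volume_preserving_equiv_real_prod.symm.lintegral_comp (by fun_prop),
    Measure.volume_eq_prod, lintegral_prod _ (by fun_prop)]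
  refine lintegral_congr fun u => lintegral_congr fun v => ?_
  simp only [Pi.mul_apply, Complex.measurableEquivRealProd_symm_apply, Complex.mk_eq_add_mul_I]
  rw [Complex.sq_norm, Complex.normSq_add_mul_I]

/-- Since `|exp(-z²/2)|² = exp(v² - u²)`, the weight loses its dependence on `v`, and what remains
is a Fourier integral in `v`. -/
theorem enorm_bargmannIntegral_sq (f : ℝ → ℂ) (u v : ℝ) :
    ENNReal.ofReal (Real.pi⁻¹ * Real.exp (-(u ^ 2 + v ^ 2))) *
        ‖bargmannIntegral f (u + v * Complex.I)‖ₑ ^ 2 =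
      ENNReal.ofReal (Real.pi⁻¹ * (Real.sqrt (2 / Real.pi) * Real.exp (-2 * u ^ 2))) *
        ‖∫ t : ℝ, (f t * Complex.exp (2 * (t : ℂ) * u - (t : ℂ) ^ 2)) *
          Complex.exp ((2 : ℝ) * Complex.I * v * t)‖ₑ ^ 2 := by
  rw [bargmannIntegral_eq_mul, enorm_mul, enorm_mul, mul_pow, mul_pow, ← mul_assoc, ← mul_assoc]
  congr 1
  · rw [← ofReal_norm, ← ofReal_norm, ← ENNReal.ofReal_pow (norm_nonneg _),
      ← ENNReal.ofReal_pow (norm_nonneg _), ← ENNReal.ofReal_mul (by positivity),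
      ← ENNReal.ofReal_mul (by positivity), Complex.norm_real, Complex.norm_exp,
      Real.norm_of_nonneg (by positivity), ← Real.rpow_natCast (_ ^ (1 / 4 : ℝ)),
      ← Real.rpow_mul (by positivity), ← Real.exp_nat_mul, Real.sqrt_eq_rpow]
    have hre : (-((u : ℂ) + v * Complex.I) ^ 2 / 2).re = (v ^ 2 - u ^ 2) / 2 := by
      simp [pow_two]
    have he : Real.exp (-2 * u ^ 2) =
        Real.exp (-(u ^ 2 + v ^ 2)) * Real.exp ((2 : ℕ) * ((v ^ 2 - u ^ 2) / 2)) := by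
      rw [← Real.exp_add]
      push_cast
      ring_nf
    rw [hre, he]
    norm_num
    ring_nf
  · congr 3 with t
    rw [mul_assoc (f t), ← Complex.exp_add]
    congr 2
    push_cast
    ring

/-- Completing the square: `-2u² + 2(2tu - t²) = -2(u - t)²`. -/
theorem enorm_mul_cexp_sq (w : ℂ) (t u : ℝ) :
    ENNReal.ofReal (Real.sqrt (2 / Real.pi) * Real.exp (-2 * u ^ 2)) *
        ‖w * Complex.exp (2 * (t : ℂ) * u - (t : ℂ) ^ 2)‖ₑ ^ 2 =
      ‖w‖ₑ ^ 2 * ENNReal.ofReal (Real.sqrt (2 / Real.pi) * Real.exp (-2 * (u - t) ^ 2)) := by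
  have hre : (2 * (t : ℂ) * u - (t : ℂ) ^ 2).re = 2 * t * u - t ^ 2 := by
    simp [pow_two]
  rw [enorm_mul, mul_pow, mul_left_comm]
  congr 1
  rw [← ofReal_norm, ← ENNReal.ofReal_pow (norm_nonneg _), ← ENNReal.ofReal_mul (by positivity),
    Complex.norm_exp, ← Real.exp_nat_mul, mul_assoc, ← Real.exp_add, hre]
  congr 3
  push_cast
  ring

/-- The Bargmann integral is isometric. -/
theorem lintegral_enorm_bargmannIntegral_sq (f : L2R) :
    ∫⁻ z, ‖bargmannIntegral f z‖ₑ ^ 2 ∂gaussC = ∫⁻ t, ‖f t‖ₑ ^ 2 := by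
  have hf : MemLp f 2 volume := Lp.memLp f
  have hfm : Measurable f := (Lp.stronglyMeasurable f).measurable
  rw [lintegral_gaussC _ (by
    have := (differentiable_bargmannIntegral hf).continuous.measurable
    fun_prop)]
  simp_rw [enorm_bargmannIntegral_sq]
  have inner (u : ℝ) :
      ∫⁻ v : ℝ, ENNReal.ofReal (Real.pi⁻¹ * (Real.sqrt (2 / Real.pi) * Real.exp (-2 * u ^ 2))) *
        ‖∫ t : ℝ, (f t * Complex.exp (2 * (t : ℂ) * u - (t : ℂ) ^ 2)) *
          Complex.exp ((2 : ℝ) * Complex.I * v * t)‖ₑ ^ 2 =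
      ∫⁻ t : ℝ, ‖f t‖ₑ ^ 2 *
        ENNReal.ofReal (Real.sqrt (2 / Real.pi) * Real.exp (-2 * (u - t) ^ 2)) := by
    -- Plancherel needs `f` times the kernel in both `L¹` and `L²`: the kernel in `L²` gives the
    -- first, its boundedness the second.
    have hk : MemLp (fun t : ℝ => Complex.exp (2 * (t : ℂ) * u - (t : ℂ) ^ 2)) 2 := by
      convert memLp_two_cexp_quadratic (b := 1) (by simp) (2 * u) 0 using 3
      ring
    have hk' : MemLp (fun t : ℝ => Complex.exp (2 * (t : ℂ) * u - (t : ℂ) ^ 2)) ⊤ := by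
      refine memLp_top_of_bound (by fun_prop) (Real.exp (u ^ 2)) (.of_forall fun t => ?_)
      have hre : (2 * (t : ℂ) * u - (t : ℂ) ^ 2).re = 2 * t * u - t ^ 2 := by
        simp [pow_two]
      rw [Complex.norm_exp, hre]
      exact Real.exp_le_exp.2 (by nlinarith [sq_nonneg (t - u)])
    have hP := lintegral_enorm_integral_cexp_sq (hf.integrable_mul hk) (hk'.mul hf) two_ne_zero
    simp only [Pi.mul_apply] at hP
    rw [lintegral_const_mul' _ _ ENNReal.ofReal_ne_top, hP,
      ← mul_assoc, ← ENNReal.ofReal_mul (by positivity)]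
    have hc : Real.pi⁻¹ * (Real.sqrt (2 / Real.pi) * Real.exp (-2 * u ^ 2)) *
        (2 * Real.pi / |2|) = Real.sqrt (2 / Real.pi) * Real.exp (-2 * u ^ 2) := by
      rw [abs_of_pos two_pos]
      field_simp
    rw [hc, ← lintegral_const_mul' _ _ ENNReal.ofReal_ne_top]
    exact lintegral_congr fun t => enorm_mul_cexp_sq (f t) t u
  simp_rw [inner]
  rw [lintegral_lintegral_swap (by fun_prop)]
  refine lintegral_congr fun t => ?_
  rw [lintegral_const_mul _ (by fun_prop), lintegral_gaussian_translate, mul_one]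

theorem FockSpace.enorm_eq (F : FockSpace) : ‖F‖ₑ = eLpNorm F 2 gaussC := by
  change ‖F.toL2‖ₑ = _
  rw [Lp.enorm_def]
  exact eLpNorm_congr_ae F.memLp.coeFn_toLp

theorem eLpNorm_bargmannIntegral (f : L2R) :
    eLpNorm (bargmannIntegral f) 2 gaussC = ‖f‖ₑ := by
  have h := lintegral_enorm_bargmannIntegral_sq f
  rw [lintegral_enorm_sq_eq_eLpNorm_sq, lintegral_enorm_sq_eq_eLpNorm_sq] at h
  rw [Lp.enorm_def]
  exact (ENNReal.pow_right_strictMono two_ne_zero).injective h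

/-- The Bargmann transform as a linear isometry. -/
def bargmannLI : L2R →ₗᵢ[ℂ] FockSpace where
  toFun f := ⟨bargmannIntegral f, differentiable_bargmannIntegral (Lp.memLp f),
    (differentiable_bargmannIntegral (Lp.memLp f)).continuous.aestronglyMeasurable, by
      rw [eLpNorm_bargmannIntegral]
      exact enorm_lt_top⟩
  map_add' f g := by
    refine Subtype.ext (funext fun z => ?_)
    change bargmannIntegral _ z = bargmannIntegral _ z + bargmannIntegral _ z
    rw [bargmannIntegral_congr_ae (Lp.coeFn_add f g)]
    simp only [bargmannIntegral, Pi.add_apply, add_mul]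
    rw [integral_add (integrable_mul_bargmannKernel (Lp.memLp f) z)
      (integrable_mul_bargmannKernel (Lp.memLp g) z), mul_add]
  map_smul' c f := by
    refine Subtype.ext (funext fun z => ?_)
    change bargmannIntegral _ z = c * bargmannIntegral _ z
    rw [bargmannIntegral_congr_ae (Lp.coeFn_smul c f)]
    simp only [bargmannIntegral, Pi.smul_apply, smul_eq_mul, mul_assoc]
    rw [integral_const_mul, mul_left_comm]
  norm_map' f := by
    rw [← toReal_enorm, ← toReal_enorm, FockSpace.enorm_eq]
    exact congrArg ENNReal.toReal (eLpNorm_bargmannIntegral f)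

theorem bargmannLI_apply (f : L2R) (z : ℂ) : bargmannLI f z = bargmannIntegral f z := rfl

/-! ### Rotations, mean values and the reproducing property -/

theorem measurePreserving_rotation_gaussC (c : Circle) :
    MeasurePreserving (fun z : ℂ => c * z) gaussC gaussC := by
  have hv : MeasurePreserving (fun z : ℂ => c * z) volume volume :=
    (rotation c).measurePreserving
  refine ⟨hv.measurable, Measure.ext fun s hs => ?_⟩
  rw [Measure.map_apply hv.measurable hs, gaussC, withDensity_apply _ (hv.measurable hs),
    withDensity_apply _ hs, ← hv.setLIntegral_comp_preimage hs (by fun_prop)]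
  simp [Circle.norm_coe]

theorem integral_gaussC (g : ℂ → ℂ) :
    ∫ z, g z ∂gaussC = ∫ z, (Real.pi⁻¹ * Real.exp (-‖z‖ ^ 2)) • g z := by
  rw [gaussC, integral_withDensity_eq_integral_toReal_smul (by fun_prop) (by simp)]
  refine integral_congr_ae (.of_forall fun z => ?_)
  simp only
  rw [ENNReal.toReal_ofReal (by positivity)]

theorem integrable_gaussC_iff (g : ℂ → ℂ) :
    Integrable g gaussC ↔ Integrable fun z => (Real.pi⁻¹ * Real.exp (-‖z‖ ^ 2)) • g z := by
  rw [gaussC, integrable_withDensity_iff_integrable_smul' (by fun_prop) (by simp)]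
  refine integrable_congr (.of_forall fun z => ?_)
  simp only
  rw [ENNReal.toReal_ofReal (by positivity)]

instance : IsProbabilityMeasure gaussC := by
  have h := GaussianFourier.integral_rexp_neg_mul_sq_norm (V := ℂ) one_pos
  simp only [neg_mul, one_mul, Complex.finrank_real_complex, div_one, Nat.cast_ofNat, ne_eq,
    OfNat.ofNat_ne_zero, not_false_eq_true, div_self, Real.rpow_one] at h
  have hi : Integrable fun z : ℂ => Real.exp (-‖z‖ ^ 2) :=
    Integrable.of_integral_ne_zero (by rw [h]; exact Real.pi_ne_zero)
  refine ⟨?_⟩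
  rw [gaussC, withDensity_apply _ .univ, Measure.restrict_univ,
    ← ofReal_integral_eq_lintegral_ofReal (hi.const_mul _) (.of_forall fun z => by positivity),
    integral_const_mul, h, inv_mul_cancel₀ Real.pi_ne_zero, ENNReal.ofReal_one]

/-- The mean value property of entire functions for the Gaussian measure. -/
theorem integral_gaussC_of_differentiable {h : ℂ → ℂ} (hd : Differentiable ℂ h)
    (hi : Integrable h gaussC) : ∫ z, h z ∂gaussC = h 0 := by
  -- By rotation invariance the integral equals its average over all rotations; Fubini then puts the
  -- circle average of `h` inside, which is `h 0`.
  have hrot (θ : ℝ) : MeasurePreserving (fun z : ℂ => circleMap 0 1 θ * z) gaussC gaussC := by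
    simpa [circleMap, Circle.coe_exp] using measurePreserving_rotation_gaussC (Circle.exp θ)
  have hemb (θ : ℝ) : MeasurableEmbedding fun z : ℂ => circleMap 0 1 θ * z :=
    (Homeomorph.mulLeft₀ _ (circleMap_ne_center one_ne_zero)).measurableEmbedding
  have hmean (z : ℂ) : ∫ θ in (0 : ℝ)..2 * Real.pi, h (circleMap 0 1 θ * z) =
      (2 * Real.pi : ℝ) • h 0 := by
    have hdiff : Differentiable ℂ fun w => h (w * z) := hd.comp (by fun_prop)
    have := (hdiff.diffContOnCl (s := Metric.ball 0 |1|)).circleAverage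
    rw [Real.circleAverage, zero_mul] at this
    rw [← this, smul_smul, mul_inv_cancel₀ Real.two_pi_pos.ne', one_smul]
  have hint : Integrable (Function.uncurry fun (θ : ℝ) (z : ℂ) => h (circleMap 0 1 θ * z))
      ((volume.restrict (Set.Ioc 0 (2 * Real.pi))).prod gaussC) := by
    have hcont : Continuous (Function.uncurry fun (θ : ℝ) (z : ℂ) => h (circleMap 0 1 θ * z)) :=
      hd.continuous.comp (by
        have := continuous_circleMap 0 1
        fun_prop)
    rw [integrable_prod_iff hcont.aestronglyMeasurable]
    refine ⟨.of_forall fun θ => (hrot θ).integrable_comp_of_integrable hi, ?_⟩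
    simp only [Function.uncurry_apply_pair]
    simp_rw [fun θ => (hrot θ).integral_comp (hemb θ) fun z => ‖h z‖]
    exact integrable_const _
  have hswap := integral_integral_swap hint
  simp_rw [fun θ => (hrot θ).integral_comp (hemb θ) h,
    ← intervalIntegral.integral_of_le Real.two_pi_pos.le, hmean] at hswap
  simp only [intervalIntegral.integral_const, sub_zero, integral_const, probReal_univ,
    one_smul] at hswap
  exact smul_right_injective ℂ Real.two_pi_pos.ne' hswap

/-- The reproducing property of the exponential kernels. -/
theorem FockSpace.inner_exp_eq {K : FockSpace} {w : ℂ}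
    (hK : ∀ z, K z = Complex.exp (starRingEnd ℂ w * z)) (f : FockSpace) :
    inner ℂ K f = f w := by
  rw [FockSpace.inner_eq_integral]
  have hi : Integrable (fun z => starRingEnd ℂ (K z) * f z) gaussC :=
    K.memLp.star.integrable_mul f.memLp
  -- Translating by `w` absorbs the conjugated kernel into the Gaussian and leaves the entire
  -- function `h`, with `h 0 = f w`.
  set h : ℂ → ℂ := fun ζ => Complex.exp (-(starRingEnd ℂ w * ζ)) * f (ζ + w) with hh
  have htrans (ζ : ℂ) : (Real.pi⁻¹ * Real.exp (-‖ζ + w‖ ^ 2)) •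
      (starRingEnd ℂ (K (ζ + w)) * f (ζ + w)) = (Real.pi⁻¹ * Real.exp (-‖ζ‖ ^ 2)) • h ζ := by
    rw [hK, ← Complex.exp_conj, hh]
    simp only [Complex.real_smul, Complex.ofReal_mul, Complex.ofReal_exp, mul_assoc]
    congr 1
    rw [← mul_assoc, ← mul_assoc, ← Complex.exp_add, ← Complex.exp_add]
    congr 2
    have hn (z : ℂ) : ((‖z‖ : ℝ) : ℂ) ^ 2 = starRingEnd ℂ z * z := (Complex.conj_mul' z).symm
    push_cast
    rw [hn, hn]
    simp only [map_mul, map_add, Complex.conj_conj]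
    ring
  have hd : Differentiable ℂ h :=
    ((by fun_prop : Differentiable ℂ fun ζ : ℂ => Complex.exp (-(starRingEnd ℂ w * ζ)))).mul
      (f.differentiable.comp (by fun_prop))
  have hi' : Integrable h gaussC := by
    rw [integrable_gaussC_iff] at hi ⊢
    exact (hi.comp_add_right w).congr (.of_forall htrans)
  have h0 : h 0 = f w := by simp [hh]
  rw [← h0, ← integral_gaussC_of_differentiable hd hi', integral_gaussC, integral_gaussC,
    ← integral_add_right_eq_self _ w]
  exact integral_congr_ae (.of_forall htrans)

/-! ### Surjectivity -/

theorem exists_bargmannLI_eq_exp (a : ℂ) :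
    ∃ ψ : L2R, ∀ z, bargmannLI ψ z = Complex.exp (a * z) := by
  set C : ℂ := (((2 / Real.pi) ^ (1 / 4 : ℝ) : ℝ) : ℂ) * (Real.pi / 2) ^ (1 / 2 : ℂ) with hC
  have hpi : (Real.pi : ℂ) ≠ 0 := by exact_mod_cast Real.pi_ne_zero
  have hC0 : C ≠ 0 := by
    refine mul_ne_zero ?_ ?_
    · exact_mod_cast (by positivity : (2 / Real.pi) ^ (1 / 4 : ℝ) ≠ 0)
    · rw [Ne, Complex.cpow_eq_zero_iff]
      simp [hpi]
  -- The Gaussian `exp(-x² + 2ax - a²/2)` has Bargmann integral `C exp(az)`, because `(a + z)²/2 -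
  -- a²/2 - z²/2 = az`.
  have hm := memLp_two_cexp_quadratic (b := 1) (by simp) (2 * a) (-a ^ 2 / 2)
  refine ⟨C⁻¹ • hm.toLp _, fun z => ?_⟩
  rw [map_smul]
  change C⁻¹ * bargmannIntegral _ z = _
  rw [inv_mul_eq_iff_eq_mul₀ hC0, bargmannIntegral_congr_ae hm.coeFn_toLp, bargmannIntegral, hC,
    mul_assoc]
  congr 1
  have hq := integral_cexp_quadratic (b := -2) (by simp) (2 * a + 2 * z) (-a ^ 2 / 2 - z ^ 2 / 2)
  rw [neg_neg] at hq
  convert hq using 2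
  · ext x
    rw [← Complex.exp_add]
    congr 1
    ring
  · congr 1
    ring

theorem bargmannLI_surjective : Function.Surjective bargmannLI := by
  set R : Submodule ℂ FockSpace := LinearMap.range bargmannLI.toLinearMap
  -- Completeness passes from `L²(ℝ)` to its isometric image, so completeness of the Fock space
  -- itself is not needed.
  have hcomplete : IsComplete (R : Set FockSpace) := by
    have : (R : Set FockSpace) = Set.range bargmannLI := by
      ext
      simp [R]
    rw [this]
    exact bargmannLI.isometry.isUniformInducing.isComplete_range
  have : CompleteSpace R := hcomplete.completeSpace_coe
  refine LinearMap.range_eq_top.1 ((Submodule.orthogonal_eq_bot_iff (K := R)).1 ?_)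
  rw [Submodule.eq_bot_iff]
  intro f hf
  refine Subtype.ext (funext fun w => ?_)
  obtain ⟨ψ, hψ⟩ := exists_bargmannLI_eq_exp (starRingEnd ℂ w)
  exact (FockSpace.inner_exp_eq hψ f).symm.trans
    ((Submodule.mem_orthogonal _ _).1 hf _ (LinearMap.mem_range_self _ ψ))

/-! ### The Fourier integral as a quarter turn -/

/-- Composition with a rotation, as a unitary operator on the Fock space. -/
def FockSpace.rotate (c : Circle) : FockSpace ≃ₗᵢ[ℂ] FockSpace where
  toFun f := ⟨fun z => f (c * z), f.differentiable.comp (by fun_prop),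
    f.memLp.comp_measurePreserving (measurePreserving_rotation_gaussC c)⟩
  invFun f := ⟨fun z => f (c⁻¹ * z), f.differentiable.comp (by fun_prop), by
    simpa [Function.comp_def] using
      f.memLp.comp_measurePreserving (measurePreserving_rotation_gaussC c⁻¹)⟩
  map_add' f g := rfl
  map_smul' a f := rfl
  left_inv f := Subtype.ext (funext fun z => congrArg (f : ℂ → ℂ) (by simp))
  right_inv f := Subtype.ext (funext fun z => congrArg (f : ℂ → ℂ) (by simp))
  norm_map' f := by
    rw [← toReal_enorm, ← toReal_enorm, FockSpace.enorm_eq, FockSpace.enorm_eq]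
    exact congrArg ENNReal.toReal
      (eLpNorm_comp_measurePreserving f.memLp.1 (measurePreserving_rotation_gaussC c))

theorem FockSpace.rotate_symm_apply (c : Circle) (f : FockSpace) (z : ℂ) :
    (FockSpace.rotate c).symm f z = f (c⁻¹ * z) := rfl

/-- The Fourier integral with kernel `exp(2iεxt)`. -/
def signedFourierIntegral (ε : ℝ) (f : ℝ → ℂ) (x : ℝ) : ℂ :=
  ((1 / Real.sqrt Real.pi : ℝ) : ℂ) *
    ∫ t : ℝ, f t * Complex.exp ((2 * ε : ℝ) * Complex.I * x * t)

theorem signedFourierIntegral_one (f : ℝ → ℂ) :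
    signedFourierIntegral 1 f = fourierIntegralPi f := by
  ext x
  simp [signedFourierIntegral, fourierIntegralPi]

theorem signedFourierIntegral_neg_one (f : ℝ → ℂ) :
    signedFourierIntegral (-1) f = fourierIntegralPiInv f := by
  ext x
  simp [signedFourierIntegral, fourierIntegralPiInv]

theorem memLp_signedFourierIntegral {ε : ℝ} (hε : ε ≠ 0) {f : L2R} (hf : Integrable f volume) :
    MemLp (signedFourierIntegral ε f) 2 := by
  have hfm : Measurable f := (Lp.stronglyMeasurable f).measurable
  have hm : StronglyMeasurable fun x : ℝ =>
      ∫ t : ℝ, f t * Complex.exp ((2 * ε : ℝ) * Complex.I * x * t) := by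
    refine StronglyMeasurable.integral_prod_right (ν := volume)
      (f := fun x t : ℝ => f t * Complex.exp ((2 * ε : ℝ) * Complex.I * x * t)) ?_
    exact Measurable.stronglyMeasurable (by fun_prop)
  refine MemLp.const_mul ⟨hm.aestronglyMeasurable, ?_⟩ _
  refine (ENNReal.pow_lt_top_iff.1 ?_).resolve_right two_ne_zero
  rw [← lintegral_enorm_sq_eq_eLpNorm_sq,
    lintegral_enorm_integral_cexp_sq hf (Lp.memLp f) (mul_ne_zero two_ne_zero hε),
    lintegral_enorm_sq_eq_eLpNorm_sq]
  exact ENNReal.mul_lt_top ENNReal.ofReal_lt_top (ENNReal.pow_lt_top (Lp.memLp f).2)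

/-- The Gaussian integral produces `(z + iεt)² - z²/2 = 2t(iεz) - t² + z²/2`, and `z² = -(iεz)²`. -/
theorem integral_cexp_mul_bargmannKernel {ε : ℝ} (hε : ε ^ 2 = 1) (t : ℝ) (z : ℂ) :
    ((1 / Real.sqrt Real.pi : ℝ) : ℂ) * ∫ x : ℝ,
      Complex.exp ((2 * ε : ℝ) * Complex.I * x * t) *
        Complex.exp (2 * (x : ℂ) * z - (x : ℂ) ^ 2 - z ^ 2 / 2) =
      Complex.exp (2 * (t : ℂ) * (ε * Complex.I * z) - (t : ℂ) ^ 2 -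
        (ε * Complex.I * z) ^ 2 / 2) := by
  have hq := integral_cexp_quadratic (b := -1) (by simp) (2 * ε * Complex.I * t + 2 * z)
    (-z ^ 2 / 2)
  have hs : ((Real.pi : ℂ) / - -1) ^ (1 / 2 : ℂ) = (Real.sqrt Real.pi : ℝ) := by
    rw [Real.sqrt_eq_rpow, Complex.ofReal_cpow Real.pi_pos.le]
    simp
  have hI : (∫ x : ℝ, Complex.exp ((2 * ε : ℝ) * Complex.I * x * t) *
      Complex.exp (2 * (x : ℂ) * z - (x : ℂ) ^ 2 - z ^ 2 / 2)) =
      ∫ x : ℝ, Complex.exp (-1 * x ^ 2 + (2 * ε * Complex.I * t + 2 * z) * x + -z ^ 2 / 2) := by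
    refine integral_congr_ae (.of_forall fun x => ?_)
    simp only
    rw [← Complex.exp_add]
    congr 1
    push_cast
    ring
  have hε' : (ε : ℂ) ^ 2 = 1 := by exact_mod_cast hε
  rw [hI, hq, hs, ← mul_assoc, ← Complex.ofReal_mul,
    one_div_mul_cancel (Real.sqrt_pos.2 Real.pi_pos).ne', Complex.ofReal_one, one_mul]
  congr 1
  linear_combination (-(z ^ 2) / 2 - t ^ 2 ) * hε' +
    (z ^ 2 * ε ^ 2 / 2 + ε ^ 2 * t ^ 2) * Complex.I_sq

/-- The Bargmann integral turns the Fourier integral into a rotation by a right angle. -/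
theorem bargmannIntegral_signedFourierIntegral {ε : ℝ} (hε : ε ^ 2 = 1) {f : L2R}
    (hf : Integrable f volume) (z : ℂ) :
    bargmannIntegral (signedFourierIntegral ε f) z =
      bargmannIntegral f (ε * Complex.I * z) := by
  have hk : Integrable fun x : ℝ => Complex.exp (2 * (x : ℂ) * z - (x : ℂ) ^ 2 - z ^ 2 / 2) := by
    convert integrable_cexp_quadratic (b := 1) (by simp) (2 * z) (-z ^ 2 / 2) using 3
    ring
  have hint : Integrable (Function.uncurry fun (x t : ℝ) =>
      Complex.exp ((2 * ε : ℝ) * Complex.I * x * t) *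
        (Complex.exp (2 * (x : ℂ) * z - (x : ℂ) ^ 2 - z ^ 2 / 2) * f t))
      (volume.prod volume) := by
    refine (hk.mul_prod hf).bdd_mul (c := 1) ?_ (.of_forall fun p => ?_)
    · exact Continuous.aestronglyMeasurable (by fun_prop)
    · have : ((2 * ε : ℝ) * Complex.I * p.1 * p.2 : ℂ) = (2 * ε * p.1 * p.2 : ℝ) * Complex.I := by
        push_cast
        ring
      rw [this, Complex.norm_exp_ofReal_mul_I]
  unfold bargmannIntegral
  congr 1
  calc ∫ x : ℝ, signedFourierIntegral ε f x *
        Complex.exp (2 * (x : ℂ) * z - (x : ℂ) ^ 2 - z ^ 2 / 2)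
      = ((1 / Real.sqrt Real.pi : ℝ) : ℂ) * ∫ x : ℝ, ∫ t : ℝ,
          Complex.exp ((2 * ε : ℝ) * Complex.I * x * t) *
            (Complex.exp (2 * (x : ℂ) * z - (x : ℂ) ^ 2 - z ^ 2 / 2) * f t) := by
        rw [← integral_const_mul]
        refine integral_congr_ae (.of_forall fun x => ?_)
        simp only [signedFourierIntegral]
        rw [mul_assoc, ← integral_mul_const]
        congr 1
        refine integral_congr_ae (.of_forall fun t => ?_)
        simp only
        ring
    _ = ∫ t : ℝ, f t * (((1 / Real.sqrt Real.pi : ℝ) : ℂ) * ∫ x : ℝ,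
          Complex.exp ((2 * ε : ℝ) * Complex.I * x * t) *
            Complex.exp (2 * (x : ℂ) * z - (x : ℂ) ^ 2 - z ^ 2 / 2)) := by
        rw [integral_integral_swap hint, ← integral_const_mul]
        refine integral_congr_ae (.of_forall fun t => ?_)
        simp only
        rw [mul_left_comm, ← integral_const_mul (f t)]
        congr 1
        refine integral_congr_ae (.of_forall fun x => ?_)
        simp only
        ring
    _ = _ := by simp_rw [integral_cexp_mul_bargmannKernel hε]

/-- Both sides have the same Bargmann integral, and `B` is injective. -/
theorem bargmann_symm_ae_eq {B : L2R ≃ₗᵢ[ℂ] FockSpace} (hB : IsBargmannTransform B) {ε : ℝ}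
    (hε : ε ^ 2 = 1) {f : L2R} (hf : Integrable f volume) {g : FockSpace}
    (hg : ∀ z, g z = B f (ε * Complex.I * z)) :
    B.symm g =ᵐ[volume] signedFourierIntegral ε f := by
  have hm := memLp_signedFourierIntegral (ε := ε) (by rintro rfl; simp at hε) hf
  have : B.symm g = hm.toLp _ := by
    rw [LinearIsometryEquiv.symm_apply_eq]
    refine Subtype.ext (funext fun z => ?_)
    rw [hg, hB, hB, bargmannIntegral_congr_ae hm.coeFn_toLp,
      bargmannIntegral_signedFourierIntegral hε hf]
  rw [this]
  exact hm.coeFn_toLp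

/-! ### Existence and uniqueness of the transforms -/

/-- The rotation by a right angle, as a unitary operator on the Fock space. -/
def quarterTurn : FockSpace ≃ₗᵢ[ℂ] FockSpace :=
  FockSpace.rotate ⟨Complex.I, mem_sphere_zero_iff_norm.2 Complex.norm_I⟩

theorem quarterTurn_apply (f : FockSpace) (z : ℂ) : quarterTurn f z = f (Complex.I * z) := rfl

theorem quarterTurn_symm_apply (f : FockSpace) (z : ℂ) :
    quarterTurn.symm f z = f (-Complex.I * z) := by
  refine (FockSpace.rotate_symm_apply _ f z).trans ?_
  exact congrArg (fun w : ℂ => f (w * z)) ((Circle.coe_inv _).trans Complex.inv_I)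

/-- The Fourier transform, as the conjugate of a quarter turn by the Bargmann transform. -/
def fourierOfBargmann (B : L2R ≃ₗᵢ[ℂ] FockSpace) : L2R ≃ₗᵢ[ℂ] L2R :=
  (B.trans quarterTurn).trans B.symm

theorem isFourierTransform_fourierOfBargmann {B : L2R ≃ₗᵢ[ℂ] FockSpace}
    (hB : IsBargmannTransform B) : IsFourierTransform (fourierOfBargmann B) := by
  intro f hf
  rw [← signedFourierIntegral_one]
  exact bargmann_symm_ae_eq hB (by norm_num) hf fun z => by simp [quarterTurn_apply]

theorem isInverseFourierTransform_fourierOfBargmann_symm {B : L2R ≃ₗᵢ[ℂ] FockSpace}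
    (hB : IsBargmannTransform B) : IsInverseFourierTransform (fourierOfBargmann B).symm := by
  intro f hf
  rw [← signedFourierIntegral_neg_one]
  exact bargmann_symm_ae_eq hB (by norm_num) hf (g := quarterTurn.symm (B f)) fun z => by
    simp [quarterTurn_symm_apply]

/-- Schwartz functions are integrable and dense in `L²`, and both operators are continuous. -/
theorem IsFourierTransform.unique {F G : L2R ≃ₗᵢ[ℂ] L2R} (hF : IsFourierTransform F)
    (hG : IsFourierTransform G) : F = G := by
  refine LinearIsometryEquiv.ext (congrFun ?_)
  refine (SchwartzMap.denseRange_toLpCLM (E := ℝ) (F := ℂ) (p := 2) (μ := volume)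
    ENNReal.ofNat_ne_top).equalizer F.continuous G.continuous (funext fun φ => ?_)
  have hi : Integrable (SchwartzMap.toLpCLM ℂ ℂ 2 (volume : Measure ℝ) φ : ℝ → ℂ) volume :=
    φ.integrable.congr (φ.coeFn_toLp 2 volume).symm
  exact Lp.ext ((hF _ hi).trans (hG _ hi).symm)

theorem IsBargmannTransform.unique {B C : L2R ≃ₗᵢ[ℂ] FockSpace} (hB : IsBargmannTransform B)
    (hC : IsBargmannTransform C) : B = C :=
  LinearIsometryEquiv.ext fun f => Subtype.ext (funext fun z => (hB f z).trans (hC f z).symm)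

/-- The Bargmann transform. -/
def bargmannTransform : L2R ≃ₗᵢ[ℂ] FockSpace :=
  LinearIsometryEquiv.ofSurjective bargmannLI bargmannLI_surjective

theorem isBargmannTransform_bargmannTransform : IsBargmannTransform bargmannTransform :=
  bargmannLI_apply

end

theorem theorem3 :
    (∃! B : L2R ≃ₗᵢ[ℂ] FockSpace, IsBargmannTransform B) ∧
    (∃! F : L2R ≃ₗᵢ[ℂ] L2R, IsFourierTransform F) ∧
    ∀ (B : L2R ≃ₗᵢ[ℂ] FockSpace) (F : L2R ≃ₗᵢ[ℂ] L2R),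
      IsBargmannTransform B → IsFourierTransform F →
        IsInverseFourierTransform F.symm ∧
        (∀ (f : FockSpace) (z : ℂ), B (F (B.symm f)) z = f (Complex.I * z)) ∧
        (∀ (f : FockSpace) (z : ℂ), B (F.symm (B.symm f)) z = f (-Complex.I * z)) := by
  refine ⟨⟨_, isBargmannTransform_bargmannTransform,
      fun C hC => hC.unique isBargmannTransform_bargmannTransform⟩,
    ⟨_, isFourierTransform_fourierOfBargmann isBargmannTransform_bargmannTransform,
      fun G hG => hG.unique (isFourierTransform_fourierOfBargmann
        isBargmannTransform_bargmannTransform)⟩, fun B F hB hF => ?_⟩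
  -- Uniqueness identifies the given `F` with the quarter turn conjugated by the given `B`.
  obtain rfl := hF.unique (isFourierTransform_fourierOfBargmann hB)
  refine ⟨isInverseFourierTransform_fourierOfBargmann_symm hB, fun f z => ?_, fun f z => ?_⟩
  · simp [fourierOfBargmann, quarterTurn_apply]
  · simp [fourierOfBargmann, quarterTurn_symm_apply]
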